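/- Fix a finite set $A$ of modalities. A Kripke frame is a structure $F=(X,(R_a)_{a\in A})$ with a (possibly empty) set $X$ and binary relations $R_a\subseteq X\times X$. Put $R_F=\bigcup_{a\in A}R_a$ and let $R_F^*$ be its reflexive transitive closure. A cluster of $F$ is an equivalence class of the relation $\{(x,y): xR_F^*y \text{ and } yR_F^*x\}$; clusters are partially ordered by $C\le D$ iff $xR_F^*y$ for some $x\in C$, $y\in D$. The height of $F$ is the supremum of the cardinalities of finite chains of clusters, and the height of a class of frames is the supremum of the heights of its members. For $Y\subseteq X$ let $F{\restriction}Y=(Y,(R_a\cap (Y\times Y))_{a\in A})$, and for a class $\mathcal F$ of Kripke frames over $A$ let $$\mathrm{clust}(\mathcal F)=\{F{\restriction}C : F\in\mathcal F,\ C \text{ a cluster of } F\}.$$ A family $\mathcal V$ of subsets of $X$ induces the equivalence $x\equiv_{\mathcal V}y$ iff for all $Y\in\mathcal V$ ($x\in Y\Leftrightarrow y\in Y$). Define equivalences $\sim_{\mathcal V,d}$ and partitions $\mathcal V_d=X/{\sim_{\mathcal V,d}}$ recursively for $d<\omega$: $\sim_{\mathcal V,0}$ is $\equiv_{\mathcal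 V}$, and $\sim_{\mathcal V,d+1}$ is the equivalence induced by the family $\mathcal V_d\cup\{R_a^{-1}[U] : a\in A,\ U\in\mathcal V_d\}$. Let $\mathcal V_\omega=\bigcup_{d<\omega}\mathcal V_d$ and $\mathrm{md}(\mathcal V)=\sup_{V\in\mathcal V_\omega}\min\{d : V\in\mathcal V_d\}$. The modal depth of $F$ is the supremum of $\mathrm{md}(\mathcal V)$ over all finite families $\mathcal V$ of subsets of $X$, and the modal depth of a class of frames is the supremum of the modal depths of its members. Corollary. Let $\mathcal F$ be a class of Kripke frames over $A$ such that the class $\mathrm{clust}(\mathcal F)$ has finite modal depth. Then $\mathcal F$ has finite modal depth if and only if $\mathcal F$ has finite height. -/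

import Mathlib

universe u v

/-- A Kripke frame over the alphabet of modalities `Al`: a (possibly empty) domain with one binary
relation for each modality. -/
structure KripkeFrame (Al : Type v) where
  /-- the domain -/
  Dom : Type u
  /-- the accessibility relation of each modality -/
  rel : Al → Dom → Dom → Prop

/-- The height of a poset: the supremum of the cardinalities of its finite chains. -/
noncomputable def posetHeight (P : Type u) [PartialOrder P] : ℕ∞ :=
  ⨆ (S : Finset P) (_ : IsChain (· ≤ ·) (S : Set P)), (S.card : ℕ∞)

/-- The equivalence on `X` induced by a family `V` of subsets of `X`. -/
def familySetoid {X : Type u} (V : Set (Set X)) : Setoid X where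
  r a b := ∀ Y ∈ V, (a ∈ Y ↔ b ∈ Y)
  iseqv :=
    ⟨fun _ _ _ => Iff.rfl, fun h Y hY => (h Y hY).symm,
      fun h₁ h₂ Y hY => (h₁ Y hY).trans (h₂ Y hY)⟩

namespace KripkeFrame

variable {Al : Type v}

/-- The union of all relations of a frame. -/
def unionRel (F : KripkeFrame.{u, v} Al) (a b : F.Dom) : Prop :=
  ∃ i : Al, F.rel i a b

/-- The reflexive transitive closure of the union of all relations of a frame. -/
def reach (F : KripkeFrame.{u, v} Al) : F.Dom → F.Dom → Prop :=
  Relation.ReflTransGen F.unionRel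

/-- Mutual reachability; its equivalence classes are the clusters of the frame. -/
def clusterSetoid (F : KripkeFrame.{u, v} Al) : Setoid F.Dom where
  r a b := F.reach a b ∧ F.reach b a
  iseqv :=
    ⟨fun _ => ⟨Relation.ReflTransGen.refl, Relation.ReflTransGen.refl⟩, fun h => ⟨h.2, h.1⟩,
      fun h₁ h₂ => ⟨h₁.1.trans h₂.1, h₂.2.trans h₁.2⟩⟩

/-- The clusters of a frame, as subsets of its domain. -/
def clusters (F : KripkeFrame.{u, v} Al) : Set (Set F.Dom) :=
  F.clusterSetoid.classes

/-- The carrier of the skeleton of a frame: the quotient by mutual reachability. -/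
def Skeleton (F : KripkeFrame.{u, v} Al) : Type u :=
  Quotient F.clusterSetoid

/-- The order of the skeleton: `C ≤ D` iff some point of `D` is reachable from some point of `C`. -/
instance (F : KripkeFrame.{u, v} Al) : PartialOrder F.Skeleton where
  le C D := ∃ a b : F.Dom,
    Quotient.mk F.clusterSetoid a = C ∧ Quotient.mk F.clusterSetoid b = D ∧ F.reach a b
  le_refl C := by
    obtain ⟨a, rfl⟩ := Quotient.exists_rep C
    exact ⟨a, a, rfl, rfl, Relation.ReflTransGen.refl⟩
  le_trans := by
    rintro _ _ _ ⟨a, b, rfl, rfl, hab⟩ ⟨b', c, hb, rfl, hbc⟩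
    have h : F.reach b b' := (Quotient.exact hb).2
    exact ⟨a, c, rfl, rfl, (hab.trans h).trans hbc⟩
  le_antisymm := by
    rintro _ _ ⟨a, b, rfl, rfl, hab⟩ ⟨b', a', hb, ha, hba⟩
    have h₁ : F.reach b b' := (Quotient.exact hb).2
    have h₂ : F.reach a' a := (Quotient.exact ha).1
    exact Quotient.sound ⟨hab, (h₁.trans hba).trans h₂⟩

/-- The height of a frame is the height of its skeleton. -/
noncomputable def height (F : KripkeFrame.{u, v} Al) : ℕ∞ :=
  posetHeight F.Skeleton

/-- The restriction of a frame to a subset of its domain. -/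
def restrict (F : KripkeFrame.{u, v} Al) (Y : Set F.Dom) : KripkeFrame.{u, v} Al where
  Dom := Y
  rel i a b := F.rel i a b

/-- The preimage `R_i⁻¹[V]` of a set under the relation of the modality `i`. -/
def relPreimage (F : KripkeFrame.{u, v} Al) (i : Al) (V : Set F.Dom) : Set F.Dom :=
  {a | ∃ b ∈ V, F.rel i a b}

/-- The equivalences `∼_{V,d}` induced by a family `V` of subsets of the domain: `∼_{V,0}` is
induced by `V`, and `∼_{V,d+1}` is induced by the set of `∼_{V,d}`-classes together with the
preimages of these classes under all relations of the frame. -/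
def inducedSetoid (F : KripkeFrame.{u, v} Al) (V : Set (Set F.Dom)) : ℕ → Setoid F.Dom
  | 0 => familySetoid V
  | d + 1 => familySetoid ((F.inducedSetoid V d).classes ∪
      {S | ∃ i : Al, ∃ U ∈ (F.inducedSetoid V d).classes, S = F.relPreimage i U})

/-- The quotient `V_d` of the domain by `∼_{V,d}`, as a set of subsets. -/
def inducedPartition (F : KripkeFrame.{u, v} Al) (V : Set (Set F.Dom)) (d : ℕ) :
    Set (Set F.Dom) :=
  (F.inducedSetoid V d).classes

/-- The union `V_ω` of all the `V_d`. -/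
def inducedUnion (F : KripkeFrame.{u, v} Al) (V : Set (Set F.Dom)) : Set (Set F.Dom) :=
  ⋃ d : ℕ, F.inducedPartition V d

/-- The least `d` such that `S ∈ V_d` (used for `S ∈ V_ω`, where such a `d` exists). -/
noncomputable def blockDepth (F : KripkeFrame.{u, v} Al) (V : Set (Set F.Dom)) (S : Set F.Dom) :
    ℕ∞ :=
  ⨅ (d : ℕ) (_ : S ∈ F.inducedPartition V d), (d : ℕ∞)

/-- The modal depth of a family `V` of subsets of the domain: the supremum of the depths of the
elements of `V_ω`. -/
noncomputable def familyDepth (F : KripkeFrame.{u, v} Al) (V : Set (Set F.Dom)) : ℕ∞ :=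
  ⨆ S ∈ F.inducedUnion V, F.blockDepth V S

/-- The modal depth of a frame: the supremum of the modal depths of the finite families of
subsets of its domain. -/
noncomputable def modalDepth (F : KripkeFrame.{u, v} Al) : ℕ∞ :=
  ⨆ (V : Set (Set F.Dom)) (_ : V.Finite), F.familyDepth V

/-- The class of the cluster-frames that are restrictions of the frames of a class to their
clusters. -/
def clust (𝓕 : Set (KripkeFrame.{u, v} Al)) : Set (KripkeFrame.{u, v} Al) :=
  {G | ∃ F ∈ 𝓕, ∃ C ∈ F.clusters, G = F.restrict C}

/-- The height of a class of frames. -/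
noncomputable def classHeight (𝓕 : Set (KripkeFrame.{u, v} Al)) : ℕ∞ :=
  ⨆ F ∈ 𝓕, F.height

/-- The modal depth of a class of frames. -/
noncomputable def classModalDepth (𝓕 : Set (KripkeFrame.{u, v} Al)) : ℕ∞ :=
  ⨆ F ∈ 𝓕, F.modalDepth

end KripkeFrame

/-! The relations `∼_{V,d}` are the `d`-round back-and-forth equivalences, and modal depth at most
`n` means that `n`-equivalence implies `d`-equivalence for every `d` (`modalDepth_le_iff`). With
finitely many modalities, a family of fixed size has finitely many depth `n` types, in a number
independent of the frame.

Finite height gives finite depth by induction on levels of clusters (`stableOn_depthBound`).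
Clusters of depth at most `m` have bounded diameter `K` (`exists_reachIn_le_card`). Let the lower
levels be stable. If some point of a cluster `C` looks like a lower point to sufficient depth, paths
of length at most `K` carry this to all of `C`, which then adds no new types
(`StableOn.sim_of_diameter_le`). Otherwise `C` is separated from the lower levels, and its stability
comes from the depth of its restriction (`stableOn_of_restrict`). Two clusters of the same level are
compared by the diameter argument again.

Conversely, two sets, rank parity and maximal rank, make points at different positions of a chain
inequivalent (`rank_separated`), so the number of types bounds the chain (`card_chain_le`). -/

namespace KripkeFrame

variable {Al : Type v}

/-! ### Back-and-forth equivalence and stabilization -/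

/-- The relation `∼_{V,d}` as a binary predicate. -/
def Sim (F : KripkeFrame.{u, v} Al) (V : Set (Set F.Dom)) (d : ℕ) (a b : F.Dom) : Prop :=
  (F.inducedSetoid V d).r a b

namespace Sim

variable {F : KripkeFrame.{u, v} Al} {V : Set (Set F.Dom)} {d e : ℕ} {a b c : F.Dom}

theorem refl (a : F.Dom) : F.Sim V d a a := (F.inducedSetoid V d).refl' a

theorem symm (h : F.Sim V d a b) : F.Sim V d b a := (F.inducedSetoid V d).symm' h

theorem trans (h : F.Sim V d a b) (h' : F.Sim V d b c) : F.Sim V d a c :=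
  (F.inducedSetoid V d).trans' h h'

theorem succ_iff : F.Sim V (d + 1) a b ↔ F.Sim V d a b ∧
    (∀ i a', F.rel i a a' → ∃ b', F.rel i b b' ∧ F.Sim V d a' b') ∧
    (∀ i b', F.rel i b b' → ∃ a', F.rel i a a' ∧ F.Sim V d a' b') := by
  constructor
  · intro h
    refine ⟨?_, fun i a' ha => ?_, fun i b' hb => ?_⟩
    · exact symm ((h _ (Or.inl ⟨a, rfl⟩)).1 (refl a))
    · obtain ⟨b', hb', hr⟩ := (h _ (Or.inr ⟨i, _, ⟨a', rfl⟩, rfl⟩)).1 ⟨a', refl a', ha⟩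
      exact ⟨b', hr, symm hb'⟩
    · obtain ⟨a', ha', hr⟩ := (h _ (Or.inr ⟨i, _, ⟨b', rfl⟩, rfl⟩)).2 ⟨b', refl b', hb⟩
      exact ⟨a', hr, ha'⟩
  · rintro ⟨h, hf, hb⟩ Y (⟨c, rfl⟩ | ⟨i, U, ⟨c, rfl⟩, rfl⟩)
    · exact ⟨fun hc => trans (symm h) hc, fun hc => trans h hc⟩
    · constructor
      · rintro ⟨a', ha', hr⟩
        obtain ⟨b', hr', hs⟩ := hf i a' hr
        exact ⟨b', trans (symm hs) ha', hr'⟩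
      · rintro ⟨b', hb', hr⟩
        obtain ⟨a', hr', hs⟩ := hb i b' hr
        exact ⟨a', trans hs hb', hr'⟩

theorem mono (h : F.Sim V e a b) (hde : d ≤ e) : F.Sim V d a b := by
  induction e, hde using Nat.le_induction with
  | base => exact h
  | succ e _ ih => exact ih (succ_iff.1 h).1

theorem forth {i : Al} {a' : F.Dom} (h : F.Sim V (d + 1) a b) (hr : F.rel i a a') :
    ∃ b', F.rel i b b' ∧ F.Sim V d a' b' := (succ_iff.1 h).2.1 i a' hr

end Sim

/-- The family `V` stabilizes at depth `n` on the set `S`. -/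
def StableOn (F : KripkeFrame.{u, v} Al) (V : Set (Set F.Dom)) (n : ℕ) (S : Set F.Dom) : Prop :=
  ∀ a ∈ S, ∀ b ∈ S, F.Sim V n a b → ∀ d, F.Sim V d a b

theorem familyDepth_le_iff (F : KripkeFrame.{u, v} Al) (V : Set (Set F.Dom)) (n : ℕ) :
    F.familyDepth V ≤ n ↔ F.StableOn V n Set.univ := by
  simp only [familyDepth, iSup_le_iff]
  constructor
  · intro h a _ b _ hab d
    have hS : {x | F.Sim V d x b} ∈ F.inducedPartition V d := ⟨b, rfl⟩
    have h1 := h _ (Set.mem_iUnion.2 ⟨d, hS⟩)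
    -- A strict bound on the infimum yields an actual depth `e ≤ n` at which this class already
    -- occurs.
    have h2 : F.blockDepth V {x | F.Sim V d x b} < ((n + 1 : ℕ) : ℕ∞) :=
      lt_of_le_of_lt h1 (by exact_mod_cast Nat.lt_succ_self n)
    simp only [blockDepth, iInf_lt_iff] at h2
    obtain ⟨e, ⟨c, hc⟩, he⟩ := h2
    have he' : e ≤ n := Nat.lt_succ_iff.1 (by exact_mod_cast he)
    have hmem : ∀ x, F.Sim V d x b ↔ F.Sim V e x c := fun x => Set.ext_iff.1 hc x
    exact (hmem a).2 ((hab.mono he').trans ((hmem b).1 (Sim.refl b)))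
  · intro h S hS
    obtain ⟨d, c, hc⟩ := Set.mem_iUnion.1 hS
    rcases le_total d n with hd | hd
    · exact (iInf₂_le d ⟨c, hc⟩).trans (by exact_mod_cast hd)
    · refine iInf₂_le n ⟨c, ?_⟩
      rw [hc]
      ext x
      exact ⟨fun hx => Sim.mono hx hd, fun hx => h x trivial c trivial hx d⟩

theorem modalDepth_le_iff (F : KripkeFrame.{u, v} Al) (n : ℕ) :
    F.modalDepth ≤ n ↔ ∀ V : Set (Set F.Dom), V.Finite → F.StableOn V n Set.univ := by
  simp only [modalDepth, iSup_le_iff, familyDepth_le_iff]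

/-! ### Counting types -/

/-- The finite set of possible depth `d` types of points, for a family of sets indexed by `ι`. -/
def Profile (Al : Type v) (ι : Type u) : ℕ → Type (max u v)
  | 0 => ULift.{v} (ι → Prop)
  | d + 1 => Profile Al ι d × (Al → Set (Profile Al ι d))

instance Profile.finite (Al : Type v) [Finite Al] (ι : Type u) [Finite ι] :
    ∀ d, Finite (Profile Al ι d)
  | 0 => inferInstanceAs (Finite (ULift.{v} (ι → Prop)))
  | d + 1 =>
    haveI := Profile.finite Al ι d
    inferInstanceAs (Finite (Profile Al ι d × (Al → Set (Profile Al ι d))))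

/-- The depth `d` type of a point. -/
def profile {ι : Type*} (F : KripkeFrame.{u, v} Al) (s : ι → Set F.Dom) :
    (d : ℕ) → F.Dom → Profile Al ι d
  | 0 => fun a => ULift.up fun j => a ∈ s j
  | d + 1 => fun a => (F.profile s d a, fun i => F.profile s d '' {b | F.rel i a b})

theorem sim_of_profile_eq {ι : Type*} (F : KripkeFrame.{u, v} Al) (s : ι → Set F.Dom) :
    ∀ (d : ℕ) (a b : F.Dom), F.profile s d a = F.profile s d b → F.Sim (Set.range s) d a b
  | 0, a, b, h => by
    rintro _ ⟨j, rfl⟩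
    exact iff_of_eq (congrFun (congrArg ULift.down h) j)
  | d + 1, a, b, h => by
    have h1 := congrArg Prod.fst h
    have h2 : ∀ i, F.profile s d '' {c | F.rel i a c} = F.profile s d '' {c | F.rel i b c} :=
      congrFun (congrArg Prod.snd h)
    refine Sim.succ_iff.2 ⟨sim_of_profile_eq F s d a b h1, fun i a' ha => ?_, fun i b' hb => ?_⟩
    · have : F.profile s d a' ∈ F.profile s d '' {c | F.rel i a c} := ⟨a', ha, rfl⟩
      rw [h2] at this
      obtain ⟨b', hb, he⟩ := this
      exact ⟨b', hb, sim_of_profile_eq F s d a' b' he.symm⟩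
    · have : F.profile s d b' ∈ F.profile s d '' {c | F.rel i b c} := ⟨b', hb, rfl⟩
      rw [← h2] at this
      obtain ⟨a', ha, he⟩ := this
      exact ⟨a', ha, sim_of_profile_eq F s d a' b' he⟩

/-- Every class is the preimage of a set of types, and there are finitely many such sets. -/
theorem finite_inducedPartition [Finite Al] (F : KripkeFrame.{u, v} Al) {V : Set (Set F.Dom)}
    (hV : V.Finite) (d : ℕ) : (F.inducedPartition V d).Finite := by
  have := hV.to_subtype
  have key : ∀ a b, F.profile (Subtype.val : V → Set F.Dom) d a = F.profile Subtype.val d b →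
      F.Sim V d a b := by
    intro a b h
    have := F.sim_of_profile_eq (Subtype.val : V → Set F.Dom) d a b h
    rwa [Subtype.range_coe] at this
  have hfin : (Set.univ : Set (Set (Profile Al V d))).Finite := Set.finite_univ
  refine (hfin.image fun T => F.profile (Subtype.val : V → Set F.Dom) d ⁻¹' T).subset ?_
  rintro S ⟨c, rfl⟩
  refine ⟨F.profile Subtype.val d '' {x | F.Sim V d x c}, trivial, ?_⟩
  ext x
  constructor
  · rintro ⟨y, hy, he⟩
    exact (key x y he.symm).trans hy
  · exact fun hx => ⟨x, hx, rfl⟩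

/-- Pairwise non-equivalent points are bounded in number by the number of types. -/
theorem le_card_profile [Finite Al] {ι : Type} [Finite ι] (F : KripkeFrame.{u, v} Al)
    (s : ι → Set F.Dom) (d k : ℕ) (p : ℕ → F.Dom)
    (hp : ∀ i < k, ∀ j < k, F.Sim (Set.range s) d (p i) (p j) → i = j) :
    k ≤ Nat.card (Profile Al ι d) := by
  have hinj : Function.Injective fun i : Fin k => F.profile s d (p i) := fun i j h =>
    Fin.ext (hp i i.2 j j.2 (F.sim_of_profile_eq s d _ _ h))
  simpa using Nat.card_le_card_of_injective _ hinj

/-! ### Paths and transfer of stability -/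

/-- Reachability in exactly `k` steps. -/
def ReachIn (F : KripkeFrame.{u, v} Al) : ℕ → F.Dom → F.Dom → Prop
  | 0, a, b => a = b
  | k + 1, a, b => ∃ c, F.unionRel a c ∧ F.ReachIn k c b

theorem reach_iff_exists_reachIn (F : KripkeFrame.{u, v} Al) {a b : F.Dom} :
    F.reach a b ↔ ∃ k, F.ReachIn k a b := by
  constructor
  · intro h
    induction h using Relation.ReflTransGen.head_induction_on with
    | refl => exact ⟨0, rfl⟩
    | head h _ ih =>
      obtain ⟨k, hk⟩ := ih
      exact ⟨k + 1, _, h, hk⟩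
  · rintro ⟨k, hk⟩
    induction k generalizing a with
    | zero => exact hk ▸ Relation.ReflTransGen.refl
    | succ k ih =>
      obtain ⟨c, hc, hk⟩ := hk
      exact Relation.ReflTransGen.head hc (ih hk)

theorem Sim.forth_reachIn {F : KripkeFrame.{u, v} Al} {V : Set (Set F.Dom)} {d k : ℕ}
    {a a' b : F.Dom} (h : F.Sim V (d + k) a b) (hr : F.ReachIn k a a') :
    ∃ b', F.ReachIn k b b' ∧ F.Sim V d a' b' := by
  induction k generalizing a b with
  | zero => exact ⟨b, rfl, hr ▸ h⟩
  | succ k ih =>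
    obtain ⟨c, ⟨i, hc⟩, hk⟩ := hr
    obtain ⟨c', hc', hs⟩ := Sim.forth (d := d + k) h hc
    obtain ⟨b', hb', hs'⟩ := ih hs hk
    exact ⟨b', ⟨c', ⟨i, hc'⟩, hb'⟩, hs'⟩

/-- Closure of a set under all relations of a frame. -/
def SuccClosed (F : KripkeFrame.{u, v} Al) (S : Set F.Dom) : Prop :=
  ∀ i a b, F.rel i a b → a ∈ S → b ∈ S

theorem SuccClosed.reachIn {F : KripkeFrame.{u, v} Al} {S : Set F.Dom} (hS : F.SuccClosed S)
    {k : ℕ} {a b : F.Dom} (h : F.ReachIn k a b) (ha : a ∈ S) : b ∈ S := by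
  induction k generalizing a with
  | zero => exact h ▸ ha
  | succ k ih =>
    obtain ⟨c, ⟨i, hc⟩, hk⟩ := h
    exact ih hk (hS i a c hc ha)

/-- If the successor closed set `S` stabilizes at depth `n` and every point of the successor closed
set `G` is `n + 1`-equivalent to some point of `S`, then `n + 1`-equivalence between points of `G`
and of `S` is full equivalence. -/
theorem StableOn.sim_of_covered {F : KripkeFrame.{u, v} Al} {V : Set (Set F.Dom)} {n : ℕ}
    {S G : Set F.Dom} (hst : F.StableOn V n S) (hS : F.SuccClosed S) (hG : F.SuccClosed G)
    (hcov : ∀ y ∈ G, ∃ s ∈ S, F.Sim V (n + 1) y s) (d : ℕ) :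
    ∀ y ∈ G, ∀ x ∈ S, F.Sim V (n + 1) y x → F.Sim V d y x := by
  -- The depth lost in one move is regained through the covering point `s`: it is `n`-equivalent to
  -- `x`, hence fully equivalent by stability.
  have key : ∀ y ∈ G, ∀ x ∈ S, F.Sim V n y x → F.Sim V (n + 1) y x := by
    intro y hy x hx h
    obtain ⟨s, hs, hys⟩ := hcov y hy
    exact hys.trans (hst s hs x hx ((hys.mono n.le_succ).symm.trans h) (n + 1))
  induction d with
  | zero => exact fun y _ x _ h => h.mono (Nat.zero_le _)
  | succ d ih =>
    intro y hy x hx h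
    refine Sim.succ_iff.2 ⟨ih y hy x hx h, fun i y' hr => ?_, fun i x' hr => ?_⟩
    · obtain ⟨x', hr', hs⟩ := (Sim.succ_iff.1 h).2.1 i y' hr
      have hy' := hG i y y' hr hy
      have hx' := hS i x x' hr' hx
      exact ⟨x', hr', ih y' hy' x' hx' (key y' hy' x' hx' hs)⟩
    · obtain ⟨y', hr', hs⟩ := (Sim.succ_iff.1 h).2.2 i x' hr
      have hy' := hG i y y' hr' hy
      have hx' := hS i x x' hr hx
      exact ⟨y', hr', ih y' hy' x' hx' (key y' hy' x' hx' hs)⟩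

/-- A path of length at most `K` from `y` to any point of `D` is matched from `x` inside `S` with `n
+ 1` rounds left, so the single pair `y`, `x` makes `S` cover all of `D`. -/
theorem StableOn.sim_of_diameter_le {F : KripkeFrame.{u, v} Al} {V : Set (Set F.Dom)} {n K : ℕ}
    {U S D : Set F.Dom} (hst : F.StableOn V n S) (hS : F.SuccClosed S) (hUS : U ⊆ S)
    (hD : F.SuccClosed (D ∪ U)) (hK : ∀ a ∈ D, ∀ b ∈ D, ∃ k ≤ K, F.ReachIn k a b)
    {x y : F.Dom} (hy : y ∈ D) (hx : x ∈ S) (h : F.Sim V (n + 1 + K) y x) (d : ℕ) :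
    F.Sim V d y x := by
  refine hst.sim_of_covered hS hD ?_ d y (Or.inl hy) x hx (h.mono (Nat.le_add_right _ _))
  rintro y' (hy' | hy')
  · obtain ⟨k, hk, hr⟩ := hK y hy y' hy'
    obtain ⟨x', hr', hs⟩ := Sim.forth_reachIn (d := n + 1) (h.mono (by omega)) hr
    exact ⟨x', hS.reachIn hr' hx, hs⟩
  · exact ⟨y', hUS hy', Sim.refl y'⟩

/-- A set `C` no point of which is `M`-equivalent to a point of a stable set `U` containing all
outer successors of `C` inherits stability from the restriction to `C`. -/
theorem stableOn_of_restrict [Finite Al] {F : KripkeFrame.{u, v} Al} {V : Set (Set F.Dom)}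
    (hV : V.Finite) {M m : ℕ} {U C : Set F.Dom} (hU : F.StableOn V M U)
    (hC : F.SuccClosed (C ∪ U))
    (hm : ∀ W : Set (Set (F.restrict C).Dom), W.Finite → (F.restrict C).StableOn W m Set.univ)
    (hsep : ∀ c ∈ C, ∀ z ∈ U, ¬ F.Sim V M c z) : F.StableOn V (M + 1 + m) C := by
  -- Depth `M + 1` in the atoms records the moves leaving `C`: their targets are known up to
  -- `M`-equivalence, which is full equivalence on `U`.
  let W : Set (Set (F.restrict C).Dom) :=
    (fun S : Set F.Dom => (Subtype.val ⁻¹' S : Set C)) '' F.inducedPartition V (M + 1)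
  have hW : W.Finite := (F.finite_inducedPartition hV _).image _
  have h0 : ∀ a b : C, (F.restrict C).Sim W 0 a b ↔ F.Sim V (M + 1) a b := by
    intro a b
    constructor
    · intro h
      have hb : b ∈ (Subtype.val ⁻¹' {x | F.Sim V (M + 1) x b} : Set C) :=
        Sim.refl (F := F) (V := V) (d := M + 1) b.1
      exact (h _ ⟨_, ⟨b, rfl⟩, rfl⟩).2 hb
    · rintro h _ ⟨_, ⟨c, rfl⟩, rfl⟩
      exact ⟨fun hc => Sim.trans h.symm hc, fun hc => Sim.trans h hc⟩
  have hstay : ∀ i (a : C) a' b, F.rel i a a' → b ∈ C → F.Sim V M a' b → a' ∈ C := by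
    intro i a a' b hr hb hs
    rcases hC i a a' hr (Or.inl a.2) with h | h
    · exact h
    · exact absurd hs.symm (hsep b hb a' h)
  have hdown : ∀ d, ∀ a b : C, F.Sim V (M + 1 + d) a b → (F.restrict C).Sim W d a b := by
    intro d
    induction d with
    | zero => exact fun a b h => (h0 a b).2 h
    | succ d ih =>
      intro a b h
      refine Sim.succ_iff.2 ⟨ih a b (h.mono (by omega)), ?_, ?_⟩
      · intro i a' hr
        obtain ⟨b', hr', hs⟩ := (Sim.succ_iff (d := M + 1 + d).1 h).2.1 i a'.1 hr
        have hb' : b' ∈ C := hstay i b b' a'.1 hr' a'.2 (hs.symm.mono (by omega))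
        exact ⟨⟨b', hb'⟩, hr', ih a' ⟨b', hb'⟩ hs⟩
      · intro i b' hr
        obtain ⟨a', hr', hs⟩ := (Sim.succ_iff (d := M + 1 + d).1 h).2.2 i b'.1 hr
        have ha' : a' ∈ C := hstay i a a' b'.1 hr' b'.2 (hs.mono (by omega))
        exact ⟨⟨a', ha'⟩, hr', ih ⟨a', ha'⟩ b' hs⟩
  have hup : ∀ d, ∀ a b : C, (∀ e, (F.restrict C).Sim W e a b) → F.Sim V d a b := by
    intro d
    induction d with
    | zero => exact fun a b h => ((h0 a b).1 (h 0)).mono (Nat.zero_le _)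
    | succ d ih =>
      intro a b h
      have hab := (h0 a b).1 (h 0)
      refine Sim.succ_iff.2 ⟨ih a b h, fun i a' hr => ?_, fun i b' hr => ?_⟩
      · rcases hC i a a' hr (Or.inl a.2) with ha' | ha'
        · obtain ⟨b', hr', hs⟩ := (Sim.succ_iff.1 (h (m + 1))).2.1 i ⟨a', ha'⟩ hr
          exact ⟨b'.1, hr', ih ⟨a', ha'⟩ b' (hm W hW _ trivial _ trivial hs)⟩
        · obtain ⟨b', hr', hs⟩ := (Sim.succ_iff.1 hab).2.1 i a' hr
          rcases hC i b b' hr' (Or.inl b.2) with hb' | hb'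
          · exact absurd hs.symm (hsep b' hb' a' ha')
          · exact ⟨b', hr', hU a' ha' b' hb' hs d⟩
      · rcases hC i b b' hr (Or.inl b.2) with hb' | hb'
        · obtain ⟨a', hr', hs⟩ := (Sim.succ_iff.1 (h (m + 1))).2.2 i ⟨b', hb'⟩ hr
          exact ⟨a'.1, hr', ih a' ⟨b', hb'⟩ (hm W hW _ trivial _ trivial hs)⟩
        · obtain ⟨a', hr', hs⟩ := (Sim.succ_iff.1 hab).2.2 i b' hr
          rcases hC i a a' hr' (Or.inl a.2) with ha' | ha'
          · exact absurd hs (hsep a' ha' b' hb')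
          · exact ⟨a', hr', hU a' ha' b' hb' hs d⟩
  exact fun a ha b hb h d => hup d ⟨a, ha⟩ ⟨b, hb⟩
    (hm W hW _ trivial _ trivial (hdown m ⟨a, ha⟩ ⟨b, hb⟩ h))

/-! ### Diameter of clusters -/

/-- In a frame of modal depth at most `m`, shortest paths have bounded length. -/
theorem exists_reachIn_le_card [Finite Al] {G : KripkeFrame.{u, v} Al} {m : ℕ}
    (hm : ∀ W : Set (Set G.Dom), W.Finite → G.StableOn W m Set.univ) {a b : G.Dom}
    (h : G.reach a b) : ∃ k ≤ Nat.card (Profile Al Unit m), G.ReachIn k a b := by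
  classical
  -- With `b` named, equivalent points have the same distance to `b`, so the points of a shortest
  -- path have distinct types.
  let s : Unit → Set G.Dom := fun _ => {b}
  have hst := hm (Set.range s) (Set.finite_range s)
  have hex := G.reach_iff_exists_reachIn.1 h
  have hpath : ∀ k (x : G.Dom), G.ReachIn k x b → (∀ j < k, ¬ G.ReachIn j x b) →
      ∃ p : ℕ → G.Dom, ∀ i ≤ k, G.ReachIn i (p i) b ∧ ∀ j < i, ¬ G.ReachIn j (p i) b := by
    intro k
    induction k with
    | zero =>
      intro x hx _
      refine ⟨fun _ => x, fun i hi => ?_⟩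
      obtain rfl := Nat.le_zero.1 hi
      exact ⟨hx, fun j hj => absurd hj (Nat.not_lt_zero j)⟩
    | succ k ih =>
      intro x hx hmin
      obtain ⟨y, hxy, hy⟩ := hx
      obtain ⟨p, hp⟩ := ih y hy fun j hj hr => hmin (j + 1) (by omega) ⟨y, hxy, hr⟩
      refine ⟨Function.update p (k + 1) x, fun i hi => ?_⟩
      rcases eq_or_lt_of_le hi with rfl | hlt
      · rw [Function.update_self]
        exact ⟨⟨y, hxy, hy⟩, hmin⟩
      · rw [Function.update_of_ne (by omega)]
        exact hp i (by omega)
  obtain ⟨p, hp⟩ := hpath (Nat.find hex) a (Nat.find_spec hex) fun j hj => Nat.find_min hex hj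
  refine ⟨Nat.find hex, ?_, Nat.find_spec hex⟩
  refine G.le_card_profile s m _ p ?_
  have half : ∀ i ≤ Nat.find hex, ∀ j ≤ Nat.find hex, G.Sim (Set.range s) m (p i) (p j) →
      j ≤ i := by
    intro i hi j hj hs
    obtain ⟨b', hb', hsim⟩ := Sim.forth_reachIn (d := 0) (hst _ trivial _ trivial hs (0 + i))
      (hp i hi).1
    have : b' = b := (hsim _ ⟨(), rfl⟩).1 rfl
    subst this
    by_contra hlt
    exact (hp j hj).2 i (not_le.1 hlt) hb'
  exact fun i hi j hj hs => le_antisymm (half j hj.le i hi.le hs.symm) (half i hi.le j hj.le hs)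

theorem reachIn_of_restrict {F : KripkeFrame.{u, v} Al} {C : Set F.Dom} {k : ℕ}
    {a b : (F.restrict C).Dom} (h : (F.restrict C).ReachIn k a b) : F.ReachIn k a.1 b.1 := by
  induction k generalizing a with
  | zero => exact congrArg Subtype.val h
  | succ k ih =>
    obtain ⟨c, hc, hk⟩ := h
    exact ⟨c.1, hc, ih hk⟩

/-- The cluster of a point. -/
def clusterOf (F : KripkeFrame.{u, v} Al) (x : F.Dom) : Set F.Dom :=
  {y | F.reach y x ∧ F.reach x y}

theorem clusterOf_mem_clusters (F : KripkeFrame.{u, v} Al) (x : F.Dom) :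
    F.clusterOf x ∈ F.clusters := ⟨x, rfl⟩

theorem reach_restrict_clusterOf {F : KripkeFrame.{u, v} Al} {x : F.Dom} {a b : F.Dom}
    (ha : a ∈ F.clusterOf x) (hb : b ∈ F.clusterOf x) (h : F.reach a b) :
    (F.restrict (F.clusterOf x)).reach ⟨a, ha⟩ ⟨b, hb⟩ := by
  induction h using Relation.ReflTransGen.head_induction_on with
  | refl => exact Relation.ReflTransGen.refl
  | @head a c hac hcb ih =>
    have hc := (⟨Relation.ReflTransGen.trans hcb hb.1,
      ha.2.trans (Relation.ReflTransGen.single hac)⟩ : c ∈ F.clusterOf x)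
    obtain ⟨i, hi⟩ := hac
    have hstep : (F.restrict (F.clusterOf x)).unionRel ⟨a, ha⟩ ⟨c, hc⟩ := ⟨i, hi⟩
    exact Relation.ReflTransGen.head hstep (ih hc)

theorem exists_reachIn_clusterOf [Finite Al] {F : KripkeFrame.{u, v} Al} {m : ℕ} {x : F.Dom}
    (hm : ∀ W : Set (Set (F.restrict (F.clusterOf x)).Dom), W.Finite →
      (F.restrict (F.clusterOf x)).StableOn W m Set.univ) :
    ∀ a ∈ F.clusterOf x, ∀ b ∈ F.clusterOf x,
      ∃ k ≤ Nat.card (Profile Al Unit m), F.ReachIn k a b := by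
  intro a ha b hb
  obtain ⟨k, hk, hr⟩ := exists_reachIn_le_card hm
    (reach_restrict_clusterOf ha hb (Relation.ReflTransGen.trans ha.1 hb.2))
  exact ⟨k, hk, reachIn_of_restrict hr⟩

/-! ### From finite height to finite modal depth -/

/-- Depth bound for frames with at most `k` levels of clusters of modal depth at most `m` and
diameter at most `K`. -/
def depthBound (m K : ℕ) : ℕ → ℕ
  | 0 => 0
  | k + 1 => depthBound m K k + 1 + K + 1 + m + 1 + K

theorem stableOn_depthBound [Finite Al] {F : KripkeFrame.{u, v} Al} {V : Set (Set F.Dom)}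
    (hV : V.Finite) {m K : ℕ}
    (hm : ∀ x, ∀ W : Set (Set (F.restrict (F.clusterOf x)).Dom), W.Finite →
      (F.restrict (F.clusterOf x)).StableOn W m Set.univ)
    (hK : ∀ x, ∀ a ∈ F.clusterOf x, ∀ b ∈ F.clusterOf x, ∃ k ≤ K, F.ReachIn k a b)
    (lev : F.Dom → ℕ) (hlev : ∀ a b, F.reach a b → b ∈ F.clusterOf a ∧ lev b = lev a ∨
      lev b < lev a) (k : ℕ) :
    F.StableOn V (depthBound m K k) {x | lev x < k} := by
  induction k with
  | zero => exact fun a ha => absurd ha (Nat.not_lt_zero _)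
  | succ k ih =>
    set n := depthBound m K k with hn
    have hstep : ∀ {i a b}, F.rel i a b → F.reach a b := fun h =>
      Relation.ReflTransGen.single ⟨_, h⟩
    have hU : F.SuccClosed {x | lev x < k} := by
      intro i a b hr ha
      rcases hlev a b (hstep hr) with h | h
      · exact h.2.trans_lt ha
      · exact h.trans ha
    have hcl : ∀ x, lev x = k → F.SuccClosed (F.clusterOf x ∪ {x | lev x < k}) := by
      rintro x hx i a b hr (ha | ha)
      · rcases hlev x b (Relation.ReflTransGen.trans ha.2 (hstep hr)) with h | h
        · exact Or.inl h.1
        · exact Or.inr (h.trans_eq hx)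
      · exact Or.inr (hU i a b hr ha)
    have hself : ∀ x, x ∈ F.clusterOf x := fun x =>
      ⟨Relation.ReflTransGen.refl, Relation.ReflTransGen.refl⟩
    have low : ∀ x, lev x = k → ∀ c ∈ F.clusterOf x, ∀ z, lev z < k →
        F.Sim V (n + 1 + K) c z → ∀ d, F.Sim V d c z := fun x hx c hc z hz h d =>
      ih.sim_of_diameter_le hU subset_rfl (hcl x hx) (hK x) hc hz h d
    have hle : n + 1 + K ≤ depthBound m K (k + 1) := by
      simp only [depthBound]; omega
    intro x hx y hy h
    rcases Nat.lt_succ_iff_lt_or_eq.1 hx with hx | hx <;>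
      rcases Nat.lt_succ_iff_lt_or_eq.1 hy with hy | hy
    · exact ih x hx y hy (h.mono (by omega))
    · exact fun d => (low y hy y (hself y) x hx (h.symm.mono hle) d).symm
    · exact low x hx x (hself x) y hy (h.mono hle)
    · by_cases hcol : ∃ z, lev z < k ∧ F.Sim V (n + 1 + K) x z
      · obtain ⟨z, hz, hs⟩ := hcol
        intro d
        exact (low x hx x (hself x) z hz hs d).trans
          (low y hy y (hself y) z hz ((h.symm.mono hle).trans hs) d).symm
      -- A collision at any `c` in the cluster is a full equivalence by `low`, and a path from `c`
      -- back to `x` would move it to `x`.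
      · have hsep : ∀ c ∈ F.clusterOf x, ∀ z ∈ {x | lev x < k},
            ¬ F.Sim V (n + 1 + K) c z := by
          intro c hc z hz hs
          obtain ⟨j, _, hr⟩ := hK x c hc x (hself x)
          obtain ⟨z', hr', hs'⟩ := (low x hx c hc z hz hs (n + 1 + K + j)).forth_reachIn hr
          exact hcol ⟨z', hU.reachIn hr' hz, hs'⟩
        have hM : F.StableOn V (n + 1 + K) {x | lev x < k} := fun a ha b hb hs =>
          ih a ha b hb (hs.mono (by omega))
        have hC := stableOn_of_restrict hV hM (hcl x hx) (hm x) hsep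
        have hS : F.StableOn V (n + 1 + K + 1 + m) (F.clusterOf x ∪ {x | lev x < k}) := by
          rintro a (ha | ha) b (hb | hb) hs
          · exact hC a ha b hb hs
          · exact absurd (hs.mono (by omega)) (hsep a ha b hb)
          · exact absurd (hs.symm.mono (by omega)) (hsep b hb a ha)
          · exact hM a ha b hb (hs.mono (by omega))
        -- The cluster of `x` with the lower levels is now the stable set; the last `1 + K` in
        -- `depthBound` pays for the cluster of `y`.
        exact fun d => (hS.sim_of_diameter_le (hcl x hx) Set.subset_union_right (hcl y hy) (hK y)
          (hself y) (Or.inl (hself x)) h.symm d).symm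

/-- The point of the skeleton given by a point of the frame. -/
def toSkeleton (F : KripkeFrame.{u, v} Al) (a : F.Dom) : F.Skeleton :=
  Quotient.mk F.clusterSetoid a

theorem toSkeleton_le_iff (F : KripkeFrame.{u, v} Al) {a b : F.Dom} :
    F.toSkeleton a ≤ F.toSkeleton b ↔ F.reach a b := by
  constructor
  · rintro ⟨a', b', ha, hb, h⟩
    have h₁ : F.reach a a' := (Quotient.exact ha).2
    have h₂ : F.reach b' b := (Quotient.exact hb).1
    exact (h₁.trans h).trans h₂
  · exact fun h => ⟨a, b, rfl, rfl, h⟩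

/-- The level is the coheight. It counts steps rather than points, so the bound has one unit of
slack. -/
theorem exists_level_of_posetHeight_le {P : Type u} [PartialOrder P] {h : ℕ}
    (hP : posetHeight P ≤ h) : ∃ lev : P → ℕ, StrictAnti lev ∧ ∀ a, lev a < h + 1 := by
  classical
  have hco : ∀ a : P, Order.coheight a ≤ h := by
    intro a
    refine Order.coheight_le fun p _ => ?_
    let S : Finset P := Finset.univ.image p
    have hS : IsChain (· ≤ ·) (S : Set P) := by
      rintro x hx y hy _
      simp only [S, Finset.coe_image, Finset.coe_univ, Set.image_univ, Set.mem_range] at hx hy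
      obtain ⟨i, rfl⟩ := hx
      obtain ⟨j, rfl⟩ := hy
      exact (le_total i j).imp (fun h => p.monotone h) (fun h => p.monotone h)
    have hcard : S.card = p.length + 1 := by
      rw [Finset.card_image_of_injective _ p.strictMono.injective, Finset.card_univ,
        Fintype.card_fin]
    have h1 : (S.card : ℕ∞) ≤ h := (le_iSup₂ (f := fun (S : Finset P)
      (_ : IsChain (· ≤ ·) (S : Set P)) => (S.card : ℕ∞)) S hS).trans hP
    rw [hcard] at h1
    have h2 : p.length + 1 ≤ h := by exact_mod_cast h1
    exact_mod_cast (Nat.le_succ _).trans h2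
  have hne : ∀ a : P, Order.coheight a ≠ ⊤ := fun a =>
    ((hco a).trans_lt (ENat.natCast_lt_top h)).ne
  refine ⟨fun a => (Order.coheight a).toNat, fun a b hab => ?_, fun a => ?_⟩
  · have := Order.coheight_strictAnti hab ((hco b).trans_lt (ENat.natCast_lt_top h))
    rwa [← ENat.natCast_toNat (hne a), ← ENat.natCast_toNat (hne b), Nat.cast_lt] at this
  · exact Nat.lt_succ_iff.2 (ENat.toNat_le_of_le_natCast (hco a))

theorem modalDepth_le_of_height_le [Finite Al] {F : KripkeFrame.{u, v} Al} {h m : ℕ}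
    (hF : F.height ≤ h) (hC : ∀ C ∈ F.clusters, (F.restrict C).modalDepth ≤ m) :
    F.modalDepth ≤ depthBound m (Nat.card (Profile Al Unit m)) (h + 1) := by
  obtain ⟨lev, hanti, hlt⟩ := exists_level_of_posetHeight_le hF
  have hm := fun x => (modalDepth_le_iff _ m).1 (hC _ (F.clusterOf_mem_clusters x))
  refine (modalDepth_le_iff _ _).2 fun V hV => ?_
  have := stableOn_depthBound hV hm (fun x => exists_reachIn_clusterOf (hm x))
    (fun x => lev (F.toSkeleton x)) ?_ (h + 1)
  · exact fun a _ b _ => this a (hlt _) b (hlt _)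
  · intro a b hab
    rcases (F.toSkeleton_le_iff.2 hab).eq_or_lt with he | hl
    · exact Or.inl ⟨(Quotient.exact he).symm, congrArg lev he.symm⟩
    · exact Or.inr (hanti hl)

/-! ### From finite modal depth to finite height -/

/-- Ranks that grow along the relations without skipping values below `h` are separated by any
depth at which the family consisting of the points of even rank and of those of rank at least `h`
stabilizes. -/
theorem rank_separated {F : KripkeFrame.{u, v} Al} {V : Set (Set F.Dom)} {n h : ℕ}
    (rk : F.Dom → ℕ) (hmono : ∀ a b, F.reach a b → rk a ≤ rk b)
    (hnext : ∀ a, rk a + 1 < h → ∃ b, F.reach a b ∧ rk b = rk a + 1)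
    (hst : F.StableOn V n Set.univ) (hV₁ : {a | Even (rk a)} ∈ V) (hV₂ : {a | h ≤ rk a} ∈ V) :
    ∀ a b, F.Sim V n a b → rk a < rk b → h ≤ rk b := by
  have hzero : ∀ {a b}, F.Sim V n a b → (Even (rk a) ↔ Even (rk b)) ∧ (h ≤ rk a ↔ h ≤ rk b) :=
    fun hs => have h0 := hst _ trivial _ trivial hs 0; ⟨h0 _ hV₁, h0 _ hV₂⟩
  have main : ∀ k a b, h - rk b = k → F.Sim V n a b → rk a < rk b → h ≤ rk b := by
    intro k
    induction k using Nat.strong_induction_on with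
    | _ k ih =>
      intro a b hk hs hab
      by_contra hlt
      -- Raising the rank of `a` by one flips its parity, so the matching `b'` lies strictly above
      -- `b`. The new pair is again strictly ordered, and by induction `b'` has rank at least `h`
      -- while `a'` does not.
      obtain ⟨a', hr, ha'⟩ := hnext a (by omega)
      obtain ⟨j, hj⟩ := F.reach_iff_exists_reachIn.1 hr
      obtain ⟨b', hb', hs'⟩ :=
        Sim.forth_reachIn (d := n) (hst _ trivial _ trivial hs (n + j)) hj
      have hbb' := hmono b b' (F.reach_iff_exists_reachIn.2 ⟨j, hb'⟩)
      have hpar := (hzero hs).1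
      have hpar' := (hzero hs').1
      have htop := (hzero hs').2
      rw [ha'] at hpar' htop
      have hne : rk b ≠ rk b' := by
        intro he
        rw [← he, ← hpar, Nat.even_add_one] at hpar'
        exact iff_not_self hpar'.symm
      have := ih (h - rk b') (by omega) a' b' rfl hs' (by omega)
      omega
  exact fun a b => main _ a b rfl

theorem card_chain_le [Finite Al] {F : KripkeFrame.{u, v} Al} {n : ℕ} (hn : F.modalDepth ≤ n)
    (S : Finset F.Skeleton) (hS : IsChain (· ≤ ·) (S : Set F.Skeleton)) :
    S.card ≤ Nat.card (Profile Al Bool n) := by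
  classical
  rcases isEmpty_or_nonempty F.Dom with hE | hE
  · have : S = ∅ := Finset.eq_empty_of_forall_notMem fun C _ => by
      obtain ⟨a, -⟩ := Quotient.exists_rep C
      exact hE.elim a
    simp [this]
  -- Counting the members of `S` not above `C` ranks every cluster, including those outside the
  -- chain, and numbers the chain itself `0, …, S.card - 1`.
  let r : F.Skeleton → ℕ := fun C => (S.filter fun D => ¬ C ≤ D).card
  have rmono : Monotone r := fun C C' hC =>
    Finset.card_le_card (Finset.monotone_filter_right S fun D _ hD hle => hD (hC.trans hle))
  have rlt : ∀ C ∈ S, ∀ C', ¬ C' ≤ C → r C < r C' ∨ ¬ C ≤ C' := by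
    intro C hC C' hCC'
    by_cases hle : C ≤ C'
    · refine Or.inl (Finset.card_lt_card (Finset.ssubset_iff_of_subset ?_ |>.2 ⟨C, ?_, ?_⟩))
      · exact Finset.monotone_filter_right S fun D _ hD hle' => hD (hle.trans hle')
      · simpa using ⟨hC, hCC'⟩
      · simp
    · exact Or.inr hle
  have rinj : Set.InjOn r S := by
    intro C hC D hD he
    by_contra hne
    rcases hS.total hC hD with hle | hle
    · rcases rlt C hC D (fun h => hne (le_antisymm hle h)) with h | h
      · omega
      · exact h hle
    · rcases rlt D hD C (fun h => hne (le_antisymm h hle)) with h | h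
      · omega
      · exact h hle
  have himg : S.image r = Finset.range S.card := by
    refine Finset.eq_of_subset_of_card_le ?_ ?_
    · intro k hk
      obtain ⟨C, hC, rfl⟩ := Finset.mem_image.1 hk
      refine Finset.mem_range.2 (Finset.card_lt_card ?_)
      exact Finset.filter_ssubset.2 ⟨C, hC, by simp⟩
    · rw [Finset.card_image_of_injOn rinj, Finset.card_range]
  have rsurj : ∀ k < S.card, ∃ C ∈ S, r C = k := fun k hk =>
    Finset.mem_image.1 (himg ▸ Finset.mem_range.2 hk)
  -- This lets any point, even outside the chain, reach the chain member of the next rank.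
  have rle : ∀ B, ∀ C ∈ S, r B ≤ r C → B ≤ C := by
    intro B C hC hBC
    by_contra hnot
    have : r C < r B := by
      refine Finset.card_lt_card (Finset.ssubset_iff_of_subset ?_ |>.2 ⟨C, ?_, by simp⟩)
      · intro D hD
        obtain ⟨hDS, hCD⟩ := Finset.mem_filter.1 hD
        refine Finset.mem_filter.2 ⟨hDS, fun hBD => ?_⟩
        exact hnot (hBD.trans ((hS.total hC hDS).resolve_left hCD))
      · simpa using ⟨hC, hnot⟩
    omega
  let rk : F.Dom → ℕ := fun a => r (F.toSkeleton a)
  have hrk : ∀ k < S.card, ∃ a, rk a = k := by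
    intro k hk
    obtain ⟨C, -, hC⟩ := rsurj k hk
    obtain ⟨a, rfl⟩ := Quotient.exists_rep C
    exact ⟨a, hC⟩
  have hnext : ∀ a, rk a + 1 < S.card → ∃ b, F.reach a b ∧ rk b = rk a + 1 := by
    intro a ha
    obtain ⟨C, hCS, hC⟩ := rsurj _ ha
    obtain ⟨b, rfl⟩ := Quotient.exists_rep C
    exact ⟨b, F.toSkeleton_le_iff.1 (rle _ _ hCS ((Nat.le_succ _).trans_eq hC.symm)), hC⟩
  choose! p hp using hrk
  let s : Bool → Set F.Dom := fun t => bif t then {a | Even (rk a)} else {a | S.card ≤ rk a}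
  have hsep := rank_separated rk (fun a b hab => rmono (F.toSkeleton_le_iff.2 hab)) hnext
    ((modalDepth_le_iff F n).1 hn (Set.range s) (Set.finite_range s)) ⟨true, rfl⟩ ⟨false, rfl⟩
  refine F.le_card_profile s n _ p fun i hi j hj hs => ?_
  have h₁ := hsep _ _ hs
  have h₂ := hsep _ _ hs.symm
  rw [hp i hi, hp j hj] at h₁ h₂
  omega

theorem height_le_of_modalDepth_le [Finite Al] {F : KripkeFrame.{u, v} Al} {n : ℕ}
    (hn : F.modalDepth ≤ n) : F.height ≤ Nat.card (Profile Al Bool n) :=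
  iSup₂_le fun S hS => by exact_mod_cast card_chain_le hn S hS

end KripkeFrame

theorem mainTheorem2 {Al : Type v} [Finite Al] (𝓕 : Set (KripkeFrame.{u, v} Al))
    (hclust : KripkeFrame.classModalDepth (KripkeFrame.clust 𝓕) < ⊤) :
    KripkeFrame.classModalDepth 𝓕 < ⊤ ↔ KripkeFrame.classHeight 𝓕 < ⊤ := by
  constructor
  · intro h
    obtain ⟨n, hn⟩ := ENat.ne_top_iff_exists.1 h.ne
    refine (iSup₂_le fun F hF => ?_).trans_lt
      (ENat.natCast_lt_top (Nat.card (KripkeFrame.Profile Al Bool n)))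
    refine KripkeFrame.height_le_of_modalDepth_le (hn ▸ ?_)
    exact le_iSup₂ (f := fun (F : KripkeFrame.{u, v} Al) (_ : F ∈ 𝓕) => F.modalDepth) F hF
  · intro h
    obtain ⟨k, hk⟩ := ENat.ne_top_iff_exists.1 h.ne
    obtain ⟨m, hm⟩ := ENat.ne_top_iff_exists.1 hclust.ne
    refine (iSup₂_le fun F hF => ?_).trans_lt (ENat.natCast_lt_top
      (KripkeFrame.depthBound m (Nat.card (KripkeFrame.Profile Al Unit m)) (k + 1)))
    refine KripkeFrame.modalDepth_le_of_height_le (hk ▸ ?_) fun C hC => hm ▸ ?_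
    · exact le_iSup₂ (f := fun (F : KripkeFrame.{u, v} Al) (_ : F ∈ 𝓕) => F.height) F hF
    · exact le_iSup₂ (f := fun (G : KripkeFrame.{u, v} Al) (_ : G ∈ KripkeFrame.clust 𝓕) =>
        G.modalDepth) (F.restrict C) ⟨F, hF, C, hC, rfl⟩
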